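/- Let $\mathbf S$ be a schema (finitely many relation symbols with arities $\ge 0$). An instance is a set of facts $R(a_1,\dots,a_n)$, finite unless stated otherwise; its active domain $\mathrm{adom}(I)$ is the set of values occurring in its facts; a homomorphism $I\to J$ is a map $\mathrm{adom}(I)\to\mathrm{adom}(J)$ that sends facts of $I$ to facts of $J$. A $k$-ary pointed instance $(I,\mathbf a)$ is an instance $I$ with a tuple $\mathbf a\in\mathrm{adom}(I)^k$. It is c-acyclic if every cycle of the incidence multigraph of $I$ (nodes: elements and facts; one edge between $a$ and $f$ for every occurrence of $a$ in $f$) contains an element of $\mathbf a$. A TGD is a sentence $\forall\mathbf x(\phi(\mathbf x)\to\exists\mathbf y\,\psi(\mathbf x,\mathbf y))$ with $\phi,\psi$ conjunctions of relational atoms. For a finite set $\Sigma$ of TGDs over $\mathbf S$, let $P_\Sigma$ be the $\exists$Datalog program with input relations $R_{in}$, output relations $R_{out}$ and auxiliary relations $R$ ($R\in\mathbf S$), whose rules are the TGDs of $\Sigma$ together with $R(\mathbf x)\leftarrow R_{in}(\mathbf x)$ and $R_{out}(\mathbf x)\leftarrow R(\mathbf x)$ for each $R\in\mathbf S$. A solution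 for a (possibly infinite) instance $I$ over the input relations is a (possibly infinite) instance over all three schemas that contains $I$ and satisfies all rules; it is universal if it maps homomorphically to every solution for $I$ by a map fixing $\mathrm{adom}(I)$ pointwise. $P_\Sigma(I)$ denotes the reduct of an arbitrary universal solution for $I$ to the output relations; it is unique up to homomorphisms in both directions that fix $\mathrm{adom}(I)$ pointwise. $\Sigma$ is weakly acyclic if the following directed graph on the pairs $(R,i)$, $R\in\mathbf S$, $1\le i\le \mathrm{arity}(R)$, has no directed cycle through a special edge: there is a normal edge $(R,i)\to(T,j)$ if, in some TGD of $\Sigma$, some variable occurs in position $i$ of an $R$-atom of the body and in position $j$ of a $T$-atom of the head, and a special edge $(R,i)\to(T,j)$ if, in some TGD of $\Sigma$, $R$ occurs in the body and a $T$-atom of the head has an existentially quantified variable in position $j$. $\Sigma$ has a generalized right-adjoint if there is a function $\Omega$ mapping each finite instance $J$ over the output relations to a finite set of pairs $(J',\iota)$, with $J'$ a finite instance over the input relations and $\iota$ a partial function from $\mathrm{adom}(J')$ to $\mathrm{adom}(J)$, such that for all finite or infinite instances $I$ over the input relations: (i) for every homomorphism $h:P_\Sigma(I)\to J$ there are $(J',\iota)\in\Omega(J)$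 and a homomorphism $h':I\to J'$ such that $\iota(h'(a))$ is defined and equal to $h(a)$ for all $a\in \mathrm{adom}(I)\cap\mathrm{adom}(P_\Sigma(I))$; and (ii) for every $(J',\iota)\in\Omega(J)$ and every homomorphism $h':I\to J'$ there is a homomorphism $h:P_\Sigma(I)\to J$ such that $\iota(h'(a))$ is defined and equal to $h(a)$ for all such $a$. A $k$-ary UCQ is a finite disjunction of $k$-ary conjunctive queries (CQs), in each of which every answer variable occurs in some conjunct; $q(I)$ is its set of answers on $I$. It is c-acyclic if the canonical instance of each of its CQs (facts: the conjuncts; distinguished elements: the answer variables) is c-acyclic. A finite collection of labeled examples is a pair $(E^+,E^-)$ of finite sets of $k$-ary finite pointed instances; it satisfies $\Sigma$ if $I\models\Sigma$ for all $(I,\mathbf a)\in E^+\cup E^-$. A $k$-ary UCQ $q$ fits $(E^+,E^-)$ if $\mathbf a\in q(I)$ for all $(I,\mathbf a)\in E^+$ and $\mathbf a\notin q(I)$ for all $(I,\mathbf a)\in E^-$. The collection uniquely characterizes $q$ with respect to $\Sigma$ if $q$ fits it and every $k$-ary UCQ $q'$ over $\mathbf S$ that fits it satisfies $q'(I)=q(I)$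 for all finite instances $I$ with $I\models\Sigma$. **Theorem.** Let $\mathbf S$ be a schema and let $\Sigma$ be a finite weakly acyclic set of TGDs over $\mathbf S$ that has a generalized right-adjoint. Then, for every $k\ge 0$, every $k$-ary c-acyclic UCQ $q$ over $\mathbf S$ is uniquely characterized with respect to $\Sigma$ by a finite collection of labeled examples that satisfies $\Sigma$. -/

import Mathlib

namespace TGDChar

/-! ### Schemas, facts, instances, homomorphisms -/

/-- A finite collection of relation symbols, each with an arity (possibly `0`). -/
structure Schema where
  Rel : Type
  arity : Rel → ℕ
  finite_rel : Finite Rel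

/-- A fact `R(a₁, …, aₙ)` with values in `V`; for `V = ℕ` read as variables, a relational atom. -/
structure Fact (S : Schema) (V : Type) where
  rel : S.Rel
  args : Fin (S.arity rel) → V

/-- The image of a fact under a map of values. -/
def Fact.map {S : Schema} {V W : Type} (h : V → W) (f : Fact S V) : Fact S W :=
  ⟨f.rel, fun i => h (f.args i)⟩

/-- A possibly infinite instance with values in `V`. Finite instances are taken over the fixed
countably infinite set `ℕ` of values; infinite ones over an arbitrary nonempty type of values. -/
abbrev Instance (S : Schema) (V : Type) := Set (Fact S V)

/-- The active domain. -/
def adom {S : Schema} {V : Type} (I : Instance S V) : Set V :=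
  {a | ∃ f ∈ I, ∃ i, f.args i = a}

/-- `h` maps every fact of `I` to a fact of `J`. A homomorphism is a map of active domains; it is
represented by a map between the ambient (nonempty) types of values, whose values outside
`adom I` are irrelevant. -/
def IsHom {S : Schema} {V W : Type} (h : V → W) (I : Instance S V) (J : Instance S W) : Prop :=
  ∀ f ∈ I, f.map h ∈ J

/-! ### Tuple-generating dependencies -/

/-- The rule `body → ∃ z, head`, where `z` consists of the variables of the head that do not
occur in the body. -/
structure TGD (S : Schema) where
  body : List (Fact S ℕ)
  head : List (Fact S ℕ)

/-- The variables that occur in the body. -/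
def TGD.bodyVars {S : Schema} (r : TGD S) : Set ℕ :=
  {x | ∃ a ∈ r.body, ∃ i, a.args i = x}

def TGD.Holds {S : Schema} {V : Type} (r : TGD S) (I : Instance S V) : Prop :=
  ∀ v : ℕ → V, (∀ a ∈ r.body, a.map v ∈ I) →
    ∃ w : ℕ → V, (∀ x ∈ r.bodyVars, w x = v x) ∧ ∀ b ∈ r.head, b.map w ∈ I

/-- `I ⊨ Γ`. -/
def Models {S : Schema} {V : Type} (I : Instance S V) (Γ : Set (TGD S)) : Prop :=
  ∀ r ∈ Γ, r.Holds I

/-! ### Existential Datalog -/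

/-- The disjoint union of an input, an output and an auxiliary schema. -/
def fullSchema (In Out Aux : Schema) : Schema where
  Rel := In.Rel ⊕ Out.Rel ⊕ Aux.Rel
  arity := Sum.elim In.arity (Sum.elim Out.arity Aux.arity)
  finite_rel := by
    have := In.finite_rel
    have := Out.finite_rel
    have := Aux.finite_rel
    infer_instance

def Fact.ofIn {In : Schema} (Out Aux : Schema) {V : Type} (f : Fact In V) :
    Fact (fullSchema In Out Aux) V :=
  ⟨Sum.inl f.rel, f.args⟩

def Fact.ofOut (In : Schema) {Out : Schema} (Aux : Schema) {V : Type} (f : Fact Out V) :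
    Fact (fullSchema In Out Aux) V :=
  ⟨Sum.inr (Sum.inl f.rel), f.args⟩

def Fact.ofAux (In Out : Schema) {Aux : Schema} {V : Type} (f : Fact Aux V) :
    Fact (fullSchema In Out Aux) V :=
  ⟨Sum.inr (Sum.inr f.rel), f.args⟩

/-- The reduct to the output schema. -/
def outReduct {In Out Aux : Schema} {V : Type} (K : Instance (fullSchema In Out Aux) V) :
    Instance Out V :=
  {f | f.ofOut In Aux ∈ K}

/-- An existential Datalog program: rules whose body uses input and auxiliary relations only, and
whose head uses output and auxiliary relations only. -/
structure Program (In Out Aux : Schema) where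
  rules : Set (TGD (fullSchema In Out Aux))
  body_mem : ∀ r ∈ rules, ∀ a ∈ r.body,
    (∃ f : Fact In ℕ, a = f.ofIn Out Aux) ∨ (∃ f : Fact Aux ℕ, a = f.ofAux In Out)
  head_mem : ∀ r ∈ rules, ∀ a ∈ r.head,
    (∃ f : Fact Out ℕ, a = f.ofOut In Aux) ∨ (∃ f : Fact Aux ℕ, a = f.ofAux In Out)

section Program

variable {In Out Aux : Schema}

/-- `K` is a solution for `I`. The inclusion `I ⊆ K` is taken along an injection `e` of the values
of `I` into the values of `K`, so that there is room for fresh values. -/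
def Program.IsSolution (P : Program In Out Aux) {V W : Type} (I : Instance In V) (e : V ↪ W)
    (K : Instance (fullSchema In Out Aux) W) : Prop :=
  (∀ f ∈ I, (f.map e).ofIn Out Aux ∈ K) ∧ Models K P.rules

/-- A solution that maps homomorphically into every solution, fixing `adom I` pointwise. -/
def Program.IsUniversalSolution (P : Program In Out Aux) {V W : Type} (I : Instance In V)
    (e : V ↪ W) (K : Instance (fullSchema In Out Aux) W) : Prop :=
  P.IsSolution I e K ∧
    ∀ (W' : Type) (e' : V ↪ W') (K' : Instance (fullSchema In Out Aux) W'),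
      P.IsSolution I e' K' → ∃ g : W → W', IsHom g K K' ∧ ∀ a ∈ adom I, g (e a) = e' a

/-- The square formed by `h : P(I) → J`, `h' : I → J'`, the identity and the partial function
`ι : adom(J') → adom(J)` commutes (on the values common to `I` and `P(I)`). -/
def Commutes {V W : Type} (I : Instance In V) (e : V ↪ W) (PI : Instance Out W)
    (h : W → ℕ) (h' : V → ℕ) (ι : ℕ →. ℕ) : Prop :=
  ∀ a ∈ adom I, e a ∈ adom PI → h (e a) ∈ ι (h' a)

/-- `Ω` assigns to every finite `J` a finite set of pairs `(J', ι)`, such that homomorphisms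
`P(I) → J` and homomorphisms `I → J'` into the members of `Ω J` give rise to each other, along
commuting squares, for all finite or infinite `I`. Here `P(I)` is the output reduct of an
arbitrary universal solution. -/
def Program.IsGeneralizedRightAdjoint (P : Program In Out Aux)
    (Ω : Instance Out ℕ → Set (Instance In ℕ × (ℕ →. ℕ))) : Prop :=
  ∀ J : Instance Out ℕ, J.Finite →
    (Ω J).Finite ∧
    (∀ p ∈ Ω J, p.1.Finite ∧ ∀ x y, y ∈ p.2 x → x ∈ adom p.1 ∧ y ∈ adom J) ∧
    ∀ (V W : Type) [Nonempty V] (I : Instance In V) (e : V ↪ W)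
      (K : Instance (fullSchema In Out Aux) W), P.IsUniversalSolution I e K →
        (∀ h : W → ℕ, IsHom h (outReduct K) J →
          ∃ p ∈ Ω J, ∃ h' : V → ℕ, IsHom h' I p.1 ∧ Commutes I e (outReduct K) h h' p.2) ∧
        (∀ p ∈ Ω J, ∀ h' : V → ℕ, IsHom h' I p.1 →
          ∃ h : W → ℕ, IsHom h (outReduct K) J ∧ Commutes I e (outReduct K) h h' p.2)

def Program.HasGeneralizedRightAdjoint (P : Program In Out Aux) : Prop :=
  ∃ Ω, P.IsGeneralizedRightAdjoint Ω

/-- The nodes `(R, i)` of the dependency graph. -/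
abbrev Position (S : Schema) := (R : S.Rel) × Fin (S.arity R)

/-- A body variable at position `p` that also occurs in the head at position `q`. -/
def Program.NormalEdge (P : Program In Out Aux) (p q : Position Aux) : Prop :=
  ∃ r ∈ P.rules, ∃ f : Fact Aux ℕ, f.ofAux In Out ∈ r.body ∧
    ∃ g : Fact Aux ℕ, g.ofAux In Out ∈ r.head ∧
      ∃ i j, f.args i = g.args j ∧ p = ⟨f.rel, i⟩ ∧ q = ⟨g.rel, j⟩

/-- The relation of `p` occurs in the body, and an existential variable occurs in the head at
position `q`. -/
def Program.SpecialEdge (P : Program In Out Aux) (p q : Position Aux) : Prop :=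
  ∃ r ∈ P.rules, ∃ f : Fact Aux ℕ, f.ofAux In Out ∈ r.body ∧
    ∃ g : Fact Aux ℕ, g.ofAux In Out ∈ r.head ∧
      ∃ i j, g.args j ∉ r.bodyVars ∧ p = ⟨f.rel, i⟩ ∧ q = ⟨g.rel, j⟩

/-- No directed cycle of the dependency graph goes through a special edge. -/
def Program.WeaklyAcyclic (P : Program In Out Aux) : Prop :=
  ∀ p q, P.SpecialEdge p q →
    ¬ Relation.ReflTransGen (fun x y => P.NormalEdge x y ∨ P.SpecialEdge x y) q p

end Program

/-! ### The program of a set of TGDs -/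

/-- The TGD with all relations read as auxiliary relations. -/
def TGD.toAux {S : Schema} (r : TGD S) : TGD (fullSchema S S S) where
  body := r.body.map (Fact.ofAux S S)
  head := r.head.map (Fact.ofAux S S)

/-- The atom `R(x₀, …, xₙ₋₁)` with distinct variables. -/
def genericAtom {S : Schema} (R : S.Rel) : Fact S ℕ :=
  ⟨R, fun i => i⟩

/-- `R(x) :- R_in(x)`. -/
def copyIn {S : Schema} (R : S.Rel) : TGD (fullSchema S S S) where
  body := [(genericAtom R).ofIn S S]
  head := [(genericAtom R).ofAux S S]

/-- `R_out(x) :- R(x)`. -/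
def copyOut {S : Schema} (R : S.Rel) : TGD (fullSchema S S S) where
  body := [(genericAtom R).ofAux S S]
  head := [(genericAtom R).ofOut S S]

/-- The program `P_Γ`: the TGDs of `Γ`, over an auxiliary copy of the schema, and the copy rules
from the input copy and to the output copy. -/
def tgdProgram {S : Schema} (Γ : Set (TGD S)) : Program S S S where
  rules := TGD.toAux '' Γ ∪ Set.range copyIn ∪ Set.range copyOut
  body_mem := by
    rintro r ((⟨t, -, rfl⟩ | ⟨R, rfl⟩) | ⟨R, rfl⟩) a ha
    · obtain ⟨f, -, rfl⟩ := List.mem_map.1 ha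
      exact Or.inr ⟨f, rfl⟩
    · exact Or.inl ⟨_, List.mem_singleton.1 ha⟩
    · exact Or.inr ⟨_, List.mem_singleton.1 ha⟩
  head_mem := by
    rintro r ((⟨t, -, rfl⟩ | ⟨R, rfl⟩) | ⟨R, rfl⟩) a ha
    · obtain ⟨f, -, rfl⟩ := List.mem_map.1 ha
      exact Or.inr ⟨f, rfl⟩
    · exact Or.inr ⟨_, List.mem_singleton.1 ha⟩
    · exact Or.inl ⟨_, List.mem_singleton.1 ha⟩

/-! ### Pointed instances and c-acyclicity -/

/-- A finite instance with `k` distinguished elements of its active domain. -/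
structure PointedInstance (S : Schema) (k : ℕ) where
  inst : Instance S ℕ
  finite_inst : inst.Finite
  point : Fin k → ℕ
  point_mem : ∀ i, point i ∈ adom inst

/-- A cycle `x₀ f₀ x₁ f₁ … xₙ fₙ x₀` of the incidence graph: a bipartite multigraph that has, for
every fact `f` and every position `i` of `f`, a separate edge between `f` and the element
`f.args i`. The edges of the cycle are those given by the positions `src j` and `tgt j` of the
fact `f_j`; the case `n = 0` is an element that occurs twice in one fact. -/
structure IncidenceCycle {S : Schema} {V : Type} (I : Instance S V) where
  n : ℕ
  elt : Fin (n + 1) → V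
  fact : Fin (n + 1) → Fact S V
  fact_mem : ∀ j, fact j ∈ I
  elt_injective : Function.Injective elt
  fact_injective : Function.Injective fact
  src : ∀ j, Fin (S.arity (fact j).rel)
  tgt : ∀ j, Fin (S.arity (fact j).rel)
  src_ne_tgt : ∀ j, src j ≠ tgt j
  args_src : ∀ j, (fact j).args (src j) = elt j
  args_tgt : ∀ j, (fact j).args (tgt j) = elt (j + 1)

/-- Every cycle of the incidence graph contains a distinguished element. -/
def PointedInstance.CAcyclic {S : Schema} {k : ℕ} (A : PointedInstance S k) : Prop :=
  ∀ C : IncidenceCycle A.inst, ∃ j i, C.elt j = A.point i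

/-! ### Unions of conjunctive queries -/

/-- A `k`-ary conjunctive query; every answer variable occurs in some conjunct, and all other
variables are existentially quantified. -/
structure CQ (S : Schema) (k : ℕ) where
  body : List (Fact S ℕ)
  head : Fin k → ℕ
  safe : ∀ i, ∃ a ∈ body, ∃ j, a.args j = head i

/-- The set `q(I)`. -/
def CQ.answers {S : Schema} {k : ℕ} (q : CQ S k) {V : Type} (I : Instance S V) :
    Set (Fin k → V) :=
  {t | ∃ v : ℕ → V, (∀ a ∈ q.body, a.map v ∈ I) ∧ ∀ i, v (q.head i) = t i}

/-- The canonical instance: the conjuncts as facts, the answer variables as distinguished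
elements. -/
def CQ.canonicalInstance {S : Schema} {k : ℕ} (q : CQ S k) : PointedInstance S k where
  inst := {f | f ∈ q.body}
  finite_inst := q.body.finite_toSet
  point := q.head
  point_mem := q.safe

/-- A finite (possibly empty) disjunction of `k`-ary conjunctive queries. -/
structure UCQ (S : Schema) (k : ℕ) where
  disjuncts : List (CQ S k)

def UCQ.answers {S : Schema} {k : ℕ} (q : UCQ S k) {V : Type} (I : Instance S V) :
    Set (Fin k → V) :=
  {t | ∃ c ∈ q.disjuncts, t ∈ c.answers I}

def UCQ.CAcyclic {S : Schema} {k : ℕ} (q : UCQ S k) : Prop :=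
  ∀ c ∈ q.disjuncts, c.canonicalInstance.CAcyclic

/-- Equivalence with respect to `Γ`: equal answers on all finite instances satisfying `Γ`. -/
def UCQ.EquivalentWrt {S : Schema} {k : ℕ} (Γ : Set (TGD S)) (q q' : UCQ S k) : Prop :=
  ∀ I : Instance S ℕ, I.Finite → Models I Γ → q.answers I = q'.answers I

/-! ### Labeled examples -/

/-- A pair of finite sets of positive and of negative examples. -/
structure LabeledExamples (S : Schema) (k : ℕ) where
  pos : Set (PointedInstance S k)
  neg : Set (PointedInstance S k)
  finite_pos : pos.Finite
  finite_neg : neg.Finite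

def UCQ.Fits {S : Schema} {k : ℕ} (q : UCQ S k) (E : LabeledExamples S k) : Prop :=
  (∀ A ∈ E.pos, A.point ∈ q.answers A.inst) ∧ (∀ A ∈ E.neg, A.point ∉ q.answers A.inst)

/-- All examples satisfy `Γ`. -/
def LabeledExamples.Satisfy {S : Schema} {k : ℕ} (E : LabeledExamples S k)
    (Γ : Set (TGD S)) : Prop :=
  (∀ A ∈ E.pos, Models A.inst Γ) ∧ (∀ A ∈ E.neg, Models A.inst Γ)

/-- `q` fits `E`, and every UCQ that fits `E` is equivalent to `q` with respect to `Γ`. -/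
def LabeledExamples.UniquelyCharacterizes {S : Schema} {k : ℕ} (E : LabeledExamples S k)
    (Γ : Set (TGD S)) (q : UCQ S k) : Prop :=
  q.Fits E ∧ ∀ q' : UCQ S k, q'.Fits E → UCQ.EquivalentWrt Γ q q'

end TGDChar

namespace TGDChar

/-! ### Basic facts on instances -/

section Chase

variable {S : Schema} {V W : Type}

/-! Positive examples force every fitting `q'` to contain `q`. For each disjunct `c` of `q`, take
the chase of its canonical instance, finite by weak acyclicity. It is a universal model, so on a
model of `Γ` every answer of `c` is the image of its distinguished tuple, hence an answer of any
`q'` accepting the example.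

Negative examples force the converse. If `t ∉ q(I)`, classify the elements of `I` by the
distinguished elements they equal and the rooted subqueries of disjuncts they satisfy. Identifying
elements of the same class creates no answer: in a c-acyclic CQ the parts hanging off a fact at its
non-distinguished positions are disjoint, so local lifts glue (`CQ.mem_answers_of_quotient`). As the
number of classes is bounded, `I` maps to one of finitely many `B`, with `t` sent to some `b ∉
q(B)`. If `I ⊨ Γ`, then `I` itself serves as `P(I)`, and the map transposes to `I → J'` with `(J',
ι) ∈ Ω B`, sending `t` to some `b'` with `ι(b') = b`. Since `J'` need not satisfy `Γ`, the example
is its chase with the image of `b'`. The example is negative for `q` because the identity of `J'`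
transposes to `P(J') → B`, which sends `b'` to `b`. A `q'` with `t ∈ q'(I)` would accept it, as
homomorphisms preserve answers. -/

theorem Fact.map_map {X : Type} (g : W → X) (h : V → W) (f : Fact S V) :
    (f.map h).map g = f.map (g ∘ h) := rfl

theorem Fact.map_congr {g h : V → W} {f : Fact S V} (H : ∀ i, g (f.args i) = h (f.args i)) :
    f.map g = f.map h := by
  simp only [Fact.map, H]

theorem adom_finite {I : Instance S V} (hI : I.Finite) : (adom I).Finite := by
  have : adom I = ⋃ f ∈ I, Set.range f.args := by
    ext a; simp [adom]
  rw [this]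
  exact hI.biUnion fun f _ => Set.finite_range _

theorem IsHom.mem_adom {h : V → W} {I : Instance S V} {J : Instance S W} (H : IsHom h I J) {a : V}
    (ha : a ∈ adom I) : h a ∈ adom J := by
  obtain ⟨f, hf, i, rfl⟩ := ha
  exact ⟨_, H f hf, i, rfl⟩

theorem finite_facts_of_values {U : Set V} (hU : U.Finite) :
    {f : Fact S V | ∀ i, f.args i ∈ U}.Finite := by
  have := S.finite_rel
  have := hU.to_subtype
  refine (Set.finite_range
    fun p : (R : S.Rel) × (Fin (S.arity R) → U) => (⟨p.1, fun i => p.2 i⟩ : Fact S V)).subset ?_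
  rintro ⟨R, t⟩ h
  exact ⟨⟨R, fun i => ⟨t i, h i⟩⟩, rfl⟩

theorem TGD.bodyVars_finite (r : TGD S) : r.bodyVars.Finite :=
  adom_finite (I := {f | f ∈ r.body}) r.body.finite_toSet

/-- A finite instance has an isomorphic copy with values in `ℕ`. -/
theorem exists_nat_copy [Nonempty V] {M : Instance S V} (hM : M.Finite) {Γ : Set (TGD S)}
    (hΓ : Models M Γ) :
    ∃ (N : Instance S ℕ) (φ : V → ℕ) (ψ : ℕ → V), N.Finite ∧ Models N Γ ∧ IsHom φ M N ∧
      IsHom ψ N M ∧ ∀ a ∈ adom M, ψ (φ a) = a := by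
  obtain ⟨φ, hφ⟩ : ∃ φ : V → ℕ, Set.InjOn φ (adom M) :=
    (Set.countable_iff_exists_injOn).1 (adom_finite hM).countable
  have hψ : ∀ a ∈ adom M, Function.invFunOn φ (adom M) (φ a) = a := fun a ha =>
    hφ.leftInvOn_invFunOn ha
  set ψ := Function.invFunOn φ (adom M)
  have hψM : ∀ f ∈ M, (f.map φ).map ψ = f := fun f hf => by
    rw [Fact.map_map]
    exact (Fact.map_congr (h := id) fun i => hψ _ ⟨f, hf, i, rfl⟩).trans rfl
  refine ⟨Fact.map φ '' M, φ, ψ, hM.image _, ?_, fun f hf => ⟨f, hf, rfl⟩, ?_, hψ⟩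
  · intro r hr v hv
    obtain ⟨w, hw, hb⟩ := hΓ r hr (ψ ∘ v) fun a ha => by
      obtain ⟨f, hf, hfa⟩ := hv a ha
      rw [← Fact.map_map, ← hfa, hψM f hf]
      exact hf
    refine ⟨φ ∘ w, ?_, fun b hbr => ⟨_, hb b hbr, rfl⟩⟩
    rintro x ⟨a, ha, i, rfl⟩
    obtain ⟨f, hf, hfa⟩ := hv a ha
    have hx : v (a.args i) ∈ adom (Fact.map φ '' M) := ⟨_, hv a ha, i, rfl⟩
    obtain ⟨_, ⟨f, hf, rfl⟩, j, hj⟩ := hx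
    simp only [Function.comp, hw _ ⟨a, ha, i, rfl⟩, ← hj, Fact.map]
    rw [hψ _ ⟨f, hf, j, rfl⟩]
  · rintro _ ⟨f, hf, rfl⟩
    rw [hψM f hf]
    exact hf

/-! ### The chase with Skolem terms -/

/-- Values of the chase: values of the instance, and nulls for the existential variable `y` of
the rule `r` under an assignment of the variables of the body. -/
inductive ChaseTerm (S : Schema) (V : Type) : Type
  | base (a : V) : ChaseTerm S V
  | null (r : TGD S) (y : ℕ) (args : r.bodyVars → ChaseTerm S V) : ChaseTerm S V

open Classical in
/-- The assignment of the variables of the head given by an assignment for the body. -/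
noncomputable def TGD.skolemize (r : TGD S) (v : ℕ → ChaseTerm S V) (x : ℕ) : ChaseTerm S V :=
  if x ∈ r.bodyVars then v x else .null r x fun z => v z

/-- The result of the chase. -/
inductive Chase (Γ : Set (TGD S)) (I : Instance S V) : Fact S (ChaseTerm S V) → Prop
  | base {f : Fact S V} (hf : f ∈ I) : Chase Γ I (f.map .base)
  | step {r : TGD S} (hr : r ∈ Γ) {v : ℕ → ChaseTerm S V} (hv : ∀ a ∈ r.body, Chase Γ I (a.map v))
      {b : Fact S ℕ} (hb : b ∈ r.head) : Chase Γ I (b.map (r.skolemize v))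

def chase (Γ : Set (TGD S)) (I : Instance S V) : Instance S (ChaseTerm S V) := {f | Chase Γ I f}

theorem isHom_chase (Γ : Set (TGD S)) (I : Instance S V) : IsHom .base I (chase Γ I) :=
  fun _ hf => Chase.base hf

theorem models_chase (Γ : Set (TGD S)) (I : Instance S V) : Models (chase Γ I) Γ :=
  fun r hr v hv => ⟨r.skolemize v, fun _ hx => if_pos hx, fun _ hb => Chase.step hr hv hb⟩

/-- A homomorphism into a model extends to the chase. -/
theorem exists_hom_of_chase [Nonempty W] {Γ : Set (TGD S)} {I : Instance S V} {N : Instance S W}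
    (hN : Models N Γ) {h : V → W} (hh : IsHom h I N) :
    ∃ g : ChaseTerm S V → W, IsHom g (chase Γ I) N ∧ ∀ a, g (.base a) = h a := by
  classical
  have key : ∀ (r : TGD S) (v : ℕ → W), ∃ w : ℕ → W, r ∈ Γ → (∀ a ∈ r.body, a.map v ∈ N) →
      (∀ x ∈ r.bodyVars, w x = v x) ∧ ∀ b ∈ r.head, b.map w ∈ N := fun r v => by
    by_cases H : r ∈ Γ ∧ ∀ a ∈ r.body, a.map v ∈ N
    · obtain ⟨w, hw⟩ := hN r H.1 v H.2
      exact ⟨w, fun _ _ => hw⟩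
    · exact ⟨v, fun h1 h2 => absurd ⟨h1, h2⟩ H⟩
  choose sk hsk using key
  let d : W := Classical.arbitrary W
  -- Recursion on terms: a null goes to the witness chosen in the model. Only the values at body
  -- variables are available, so the assignment is padded by `d`; the padded `u` below makes this
  -- match definitionally.
  let g : ChaseTerm S V → W := fun t => t.rec h fun r y _ ih =>
    sk r (fun x => if hx : x ∈ r.bodyVars then ih ⟨x, hx⟩ else d) y
  refine ⟨g, fun f hf => ?_, fun a => rfl⟩
  induction hf with
  | base hf => exact hh _ hf
  | @step r hr v hv b hb ih =>
    let u : ℕ → W := fun x => if x ∈ r.bodyVars then g (v x) else d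
    have hu : ∀ a ∈ r.body, a.map u ∈ N := fun a ha => by
      have : a.map u = a.map (g ∘ v) := Fact.map_congr fun i =>
        if_pos (show a.args i ∈ r.bodyVars from ⟨a, ha, i, rfl⟩)
      rw [this]
      exact ih a ha
    obtain ⟨h1, h2⟩ := hsk r u hr hu
    have : (b.map (r.skolemize v)).map g = b.map (sk r u) := by
      rw [Fact.map_map]
      refine Fact.map_congr fun i => ?_
      by_cases hx : b.args i ∈ r.bodyVars
      · rw [h1 _ hx]
        simp [TGD.skolemize, hx, u]
      · simp only [Function.comp, TGD.skolemize, if_neg hx]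
        rfl
    rw [this]
    exact h2 b hb

/-- The values of the chase at a position. -/
def chaseValues (Γ : Set (TGD S)) (I : Instance S V) (p : Position S) : Set (ChaseTerm S V) :=
  {t | ∃ f ∈ chase Γ I, ∃ i, p = ⟨f.rel, i⟩ ∧ t = f.args i}

theorem normalEdge_of_mem {Γ : Set (TGD S)} {r : TGD S} (hr : r ∈ Γ) {f g : Fact S ℕ}
    (hf : f ∈ r.body) (hg : g ∈ r.head) {i : Fin (S.arity f.rel)} {j : Fin (S.arity g.rel)}
    (h : f.args i = g.args j) : (tgdProgram Γ).NormalEdge ⟨f.rel, i⟩ ⟨g.rel, j⟩ :=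
  ⟨r.toAux, .inl (.inl ⟨r, hr, rfl⟩), f, List.mem_map_of_mem hf, g, List.mem_map_of_mem hg, i, j, h,
    rfl, rfl⟩

theorem TGD.bodyVars_toAux (r : TGD S) : r.toAux.bodyVars = r.bodyVars := by
  ext x
  constructor
  · rintro ⟨a, ha, i, rfl⟩
    obtain ⟨f, hf, rfl⟩ := List.mem_map.1 ha
    exact ⟨f, hf, i, rfl⟩
  · rintro ⟨f, hf, i, rfl⟩
    exact ⟨_, List.mem_map_of_mem hf, i, rfl⟩

theorem specialEdge_of_mem {Γ : Set (TGD S)} {r : TGD S} (hr : r ∈ Γ) {f g : Fact S ℕ}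
    (hf : f ∈ r.body) (hg : g ∈ r.head) (i : Fin (S.arity f.rel)) {j : Fin (S.arity g.rel)}
    (h : g.args j ∉ r.bodyVars) : (tgdProgram Γ).SpecialEdge ⟨f.rel, i⟩ ⟨g.rel, j⟩ :=
  ⟨r.toAux, .inl (.inl ⟨r, hr, rfl⟩), f, List.mem_map_of_mem hf, g, List.mem_map_of_mem hg, i, j,
    by rwa [r.bodyVars_toAux], rfl, rfl⟩

/-- Well-founded induction along paths that begin with a special edge. Special edges leave all
positions of all body atoms, so every argument of a null created at a position leading to `q` sits
at a position preceding `q`, where only finitely many values occur. -/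
theorem chaseValues_finite {Γ : Set (TGD S)} (hfin : Γ.Finite)
    (hwa : (tgdProgram Γ).WeaklyAcyclic) {I : Instance S V} (hI : I.Finite) (q : Position S) :
    (chaseValues Γ I q).Finite := by
  have := S.finite_rel
  let E : Position S → Position S → Prop := fun x y =>
    (tgdProgram Γ).NormalEdge x y ∨ (tgdProgram Γ).SpecialEdge x y
  let prec : Position S → Position S → Prop := fun p q =>
    ∃ m, (tgdProgram Γ).SpecialEdge p m ∧ Relation.ReflTransGen E m q
  have : IsTrans _ prec := ⟨by
    rintro a b c ⟨m, hm, hmb⟩ ⟨m', hm', hmc⟩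
    exact ⟨m, hm, hmb.trans (.head (.inr hm') hmc)⟩⟩
  have : Std.Irrefl prec := ⟨fun a ⟨m, hm, hma⟩ => hwa _ _ hm hma⟩
  have wf : WellFounded prec := Finite.wellFounded_of_trans_of_irrefl prec
  induction q using wf.induction with
  | _ q ih =>
  let U : Set (ChaseTerm S V) := ⋃ p ∈ {p | prec p q}, chaseValues Γ I p
  have hU : U.Finite := (Set.toFinite {p | prec p q}).biUnion ih
  let B : Set (ChaseTerm S V) := .base '' adom I ∪
    ⋃ r ∈ Γ, ⋃ y ∈ adom {f | f ∈ r.head}, ChaseTerm.null r y '' {args | ∀ z, args z ∈ U}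
  have hB : B.Finite := by
    refine ((adom_finite hI).image _).union (hfin.biUnion fun r _ =>
      (adom_finite r.head.finite_toSet).biUnion fun y _ => Set.Finite.image _ ?_)
    have := r.bodyVars_finite.to_subtype
    exact Set.Finite.pi' fun _ => hU
  -- Stated for all positions from which `q` is reachable, since a value copied by a rule comes from
  -- an earlier position along a normal edge.
  have main : ∀ f, Chase Γ I f → ∀ i, Relation.ReflTransGen E ⟨f.rel, i⟩ q → f.args i ∈ B := by
    intro f hf
    induction hf with
    | @base f hf => exact fun i _ => .inl ⟨_, ⟨f, hf, i, rfl⟩, rfl⟩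
    | @step r hr v hv b hb ihb =>
      intro i hi
      change r.skolemize v (b.args i) ∈ B
      by_cases hx : b.args i ∈ r.bodyVars
      · rw [TGD.skolemize, if_pos hx]
        obtain ⟨a, ha, j, hj⟩ := hx
        rw [← hj]
        exact ihb a ha j (.head (.inl (normalEdge_of_mem hr ha hb hj)) hi)
      · rw [TGD.skolemize, if_neg hx]
        refine .inr (Set.mem_biUnion hr (Set.mem_biUnion ⟨b, hb, i, rfl⟩ ⟨_, ?_, rfl⟩))
        rintro ⟨_, a, ha, j, rfl⟩
        exact Set.mem_biUnion (x := ⟨a.rel, j⟩) ⟨_, specialEdge_of_mem hr ha hb j hx, hi⟩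
          ⟨_, hv a ha, j, rfl, rfl⟩
  refine hB.subset ?_
  rintro _ ⟨f, hf, i, rfl, rfl⟩
  exact main f hf i .refl

theorem chase_finite {Γ : Set (TGD S)} (hfin : Γ.Finite)
    (hwa : (tgdProgram Γ).WeaklyAcyclic) {I : Instance S V} (hI : I.Finite) :
    (chase Γ I).Finite := by
  have := S.finite_rel
  refine (finite_facts_of_values (Set.finite_iUnion (chaseValues_finite hfin hwa hI))).subset ?_
  exact fun f hf i => Set.mem_iUnion.2 ⟨⟨f.rel, i⟩, f, hf, i, rfl, rfl⟩

/-! ### Universal solutions of the program of a set of TGDs -/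

/-- The solution with the input relations of `I` (along `e`), and with the output and the
auxiliary relations of `M`. -/
def solutionOf (I : Instance S V) (e : V → W) (M : Instance S W) :
    Instance (fullSchema S S S) W :=
  {F | match F with
    | ⟨.inl R, t⟩ => ∃ f ∈ I, f.map e = ⟨R, t⟩
    | ⟨.inr (.inl R), t⟩ => (⟨R, t⟩ : Fact S W) ∈ M
    | ⟨.inr (.inr R), t⟩ => (⟨R, t⟩ : Fact S W) ∈ M}

theorem Fact.eq_map_genericAtom [Nonempty V] (f : Fact S V) :
    ∃ v : ℕ → V, (genericAtom f.rel).map v = f :=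
  ⟨fun n => if h : n < S.arity f.rel then f.args ⟨n, h⟩ else Classical.arbitrary V, by
    simp [genericAtom, Fact.map]⟩

/-- In any solution the copy rules put the input facts into the auxiliary relations and those into
the output. So its auxiliary reduct is a model of `Γ` containing `I`, and a homomorphism from `M`
into it respects all three schemas. This serves both for the chase of `I` and for `M = I` when `I ⊨
Γ`. -/
theorem isUniversalSolution_solutionOf [Nonempty V] {Γ : Set (TGD S)} {I : Instance S V}
    {e : V ↪ W} {M : Instance S W} (hM : Models M Γ) (he : IsHom e I M)
    (huniv : ∀ (X : Type) [Nonempty X] (N : Instance S X) (h : V → X), Models N Γ → IsHom h I N →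
      ∃ g : W → X, IsHom g M N ∧ ∀ a ∈ adom I, g (e a) = h a) :
    (tgdProgram Γ).IsUniversalSolution I e (solutionOf I e M) := by
  refine ⟨⟨fun f hf => ⟨f, hf, rfl⟩, ?_⟩, ?_⟩
  · rintro r ((⟨t, ht, rfl⟩ | ⟨R, rfl⟩) | ⟨R, rfl⟩) v hv
    · obtain ⟨w, hw, hb⟩ := hM t ht v fun a ha => hv _ (List.mem_map_of_mem ha)
      refine ⟨w, by rwa [t.bodyVars_toAux], fun b hbt => ?_⟩
      obtain ⟨g, hg, rfl⟩ := List.mem_map.1 hbt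
      exact hb g hg
    · refine ⟨v, fun _ _ => rfl, fun b hb => ?_⟩
      obtain rfl := List.mem_singleton.1 hb
      obtain ⟨f, hf, hfe⟩ := hv _ (List.mem_singleton_self _)
      have : (genericAtom R).map v ∈ M := by
        have h := he f hf
        rw [hfe] at h
        exact h
      exact this
    · refine ⟨v, fun _ _ => rfl, fun b hb => ?_⟩
      obtain rfl := List.mem_singleton.1 hb
      have : (genericAtom R).map v ∈ M :=
        hv ((genericAtom R).ofAux S S) (List.mem_singleton_self _)
      exact this
  · intro X e' K' hK'
    have : Nonempty X := ‹Nonempty V›.map e'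
    -- Both kinds of copy rules at once; the third hypothesis says that the body contains every
    -- variable of the atom, so nothing is existential.
    have hcopy : ∀ (R R' : Fact S ℕ → Fact (fullSchema S S S) ℕ)
        (T T' : Fact S X → Fact (fullSchema S S S) X),
        (∀ f (v : ℕ → X), (R f).map v = T (f.map v)) →
        (∀ f (v : ℕ → X), (R' f).map v = T' (f.map v)) →
        (∀ f i, ∃ j, (R f).args j = f.args i) →
        (∀ Q : S.Rel, (⟨[R (genericAtom Q)], [R' (genericAtom Q)]⟩ : TGD _) ∈ (tgdProgram Γ).rules) →
        ∀ f, T f ∈ K' → T' f ∈ K' := by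
      intro R R' T T' h1 h2 h3 h4 f hf
      obtain ⟨v, hv⟩ := f.eq_map_genericAtom
      obtain ⟨w, hw, hb⟩ := hK'.2 _ (h4 f.rel) v (by
        intro a ha
        obtain rfl := List.mem_singleton.1 ha
        rwa [h1, hv])
      have hb' := hb _ (List.mem_singleton_self _)
      rw [h2] at hb'
      have : (genericAtom f.rel).map w = (genericAtom f.rel).map v := Fact.map_congr fun i => by
        obtain ⟨j, hj⟩ := h3 (genericAtom f.rel) i
        exact hw _ ⟨_, List.mem_singleton_self _, j, hj⟩
      rwa [this, hv] at hb'
    have hin : ∀ f : Fact S X, f.ofIn S S ∈ K' → f.ofAux S S ∈ K' :=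
      hcopy (Fact.ofIn S S) (Fact.ofAux S S) _ _ (fun _ _ => rfl) (fun _ _ => rfl)
        (fun _ i => ⟨i, rfl⟩) fun Q => .inl (.inr ⟨Q, rfl⟩)
    have hout : ∀ f : Fact S X, f.ofAux S S ∈ K' → f.ofOut S S ∈ K' :=
      hcopy (Fact.ofAux S S) (Fact.ofOut S S) _ _ (fun _ _ => rfl) (fun _ _ => rfl)
        (fun _ i => ⟨i, rfl⟩) fun Q => .inr ⟨Q, rfl⟩
    obtain ⟨g, hg, hge⟩ := huniv X {f | f.ofAux S S ∈ K'} e' (by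
        intro r hr v hv
        obtain ⟨w, hw, hb⟩ := hK'.2 r.toAux (.inl (.inl ⟨r, hr, rfl⟩)) v fun a ha => by
          obtain ⟨f, hf, rfl⟩ := List.mem_map.1 ha
          exact hv f hf
        rw [r.bodyVars_toAux] at hw
        exact ⟨w, hw, fun b hb' => hb _ (List.mem_map_of_mem hb')⟩)
      (fun f hf => hin _ (hK'.1 f hf))
    refine ⟨g, ?_, hge⟩
    rintro ⟨R | R | R, t⟩ hF
    · obtain ⟨f, hf, hfe⟩ := hF
      have h1 : (⟨R, t⟩ : Fact S W).map g = f.map e' := by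
        rw [← hfe, Fact.map_map]
        exact Fact.map_congr fun i => hge _ ⟨f, hf, i, rfl⟩
      have h2 := hK'.1 f hf
      rw [← h1] at h2
      exact h2
    · exact hout _ (hg ⟨R, t⟩ hF)
    · exact hg ⟨R, t⟩ hF

end Chase

/-! ### Shortest chains -/

/-- `b` is reached from `a` in exactly `n` steps of the relation `R`. -/
def ReachIn {α : Type} (R : α → α → Prop) (a : α) : ℕ → α → Prop
  | 0, b => b = a
  | n + 1, b => ∃ c, ReachIn R a n c ∧ R c b

theorem exists_reachIn {α : Type} {R : α → α → Prop} {a b : α} (h : Relation.ReflTransGen R a b) :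
    ∃ n, ReachIn R a n b := by
  induction h with
  | refl => exact ⟨0, rfl⟩
  | tail _ h ih =>
    obtain ⟨n, hn⟩ := ih
    exact ⟨n + 1, _, hn, h⟩

/-- The predecessor on a shortest path is itself at minimal distance, so `x j` has distance exactly
`j`. Comparing distances later excludes repetitions and shortcuts. -/
theorem exists_geodesic {α : Type} {R : α → α → Prop} {a : α} (m : ℕ) : ∀ {b : α},
    ReachIn R a m b → (∀ n < m, ¬ ReachIn R a n b) →
    ∃ x : ℕ → α, x m = b ∧ (∀ j < m, R (x j) (x (j + 1))) ∧
      ∀ j ≤ m, ReachIn R a j (x j) ∧ ∀ n < j, ¬ ReachIn R a n (x j) := by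
  induction m with
  | zero =>
    intro b hb _
    exact ⟨fun _ => b, rfl, fun j hj => absurd hj (Nat.not_lt_zero j), fun j hj => by
      obtain rfl := Nat.le_zero.1 hj
      exact ⟨hb, fun n hn => absurd hn (Nat.not_lt_zero n)⟩⟩
  | succ m ih =>
    rintro b ⟨c, hc, hcb⟩ hmin
    obtain ⟨x, hxm, hstep, hx⟩ := ih hc fun n hn h => hmin (n + 1) (by omega) ⟨c, h, hcb⟩
    refine ⟨fun j => if j ≤ m then x j else b, by simp, fun j hj => ?_, fun j hj => ?_⟩
    · rcases Nat.lt_succ_iff_lt_or_eq.1 hj with h | rfl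
      · simpa [h.le, Nat.succ_le_of_lt h] using hstep j h
      · simpa [hxm] using hcb
    · rcases Nat.le_succ_iff.1 hj with h | rfl
      · simpa [h] using hx j h
      · simp only [if_neg (Nat.not_succ_le_self m)]
        exact ⟨⟨c, hc, hcb⟩, hmin⟩

/-- A shortest chain has no shortcuts. -/
theorem exists_chain_without_shortcut {α : Type} {R : α → α → Prop} {a b : α}
    (h : Relation.ReflTransGen R a b) :
    ∃ (m : ℕ) (x : ℕ → α), x 0 = a ∧ x m = b ∧ (∀ j < m, R (x j) (x (j + 1))) ∧
      (∀ i ≤ m, ∀ j ≤ m, x i = x j → i = j) ∧ ∀ i ≤ m, ∀ j ≤ m, R (x i) (x j) → j ≤ i + 1 := by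
  classical
  have H := exists_reachIn h
  obtain ⟨x, hxm, hstep, hx⟩ := exists_geodesic _ (Nat.find_spec H) fun n hn => Nat.find_min H hn
  refine ⟨_, x, (hx 0 (Nat.zero_le _)).1, hxm, hstep, fun i hi j hj hij => ?_,
    fun i hi j hj hij => ?_⟩
  · by_contra hne
    rcases Nat.lt_or_gt_of_ne hne with h | h
    · exact (hx j hj).2 i h (hij ▸ (hx i hi).1)
    · exact (hx i hi).2 j h (hij ▸ (hx j hj).1)
  · by_contra hlt
    exact (hx j hj).2 (i + 1) (by omega) ⟨_, (hx i hi).1, hij⟩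

/-! ### c-acyclicity -/

/-- `x` and `y` are outside `D` and occur in a common fact of `G`. -/
def Link {S : Schema} {V : Type} (G : Instance S V) (D : Set V) (x y : V) : Prop :=
  x ∉ D ∧ y ∉ D ∧ ∃ g ∈ G, (∃ i, g.args i = x) ∧ ∃ j, g.args j = y

theorem Link.symm {S : Schema} {V : Type} {G : Instance S V} {D : Set V} {x y : V}
    (h : Link G D x y) : Link G D y x :=
  let ⟨hx, hy, g, hg, hi, hj⟩ := h
  ⟨hy, hx, g, hg, hj, hi⟩

/-- Two positions of a fact are not connected by other facts and non-distinguished elements. -/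
theorem PointedInstance.CAcyclic.eq_of_linked {S : Schema} {k : ℕ} {A : PointedInstance S k}
    (hA : A.CAcyclic) {G : Instance S ℕ} (hG : G ⊆ A.inst) {f : Fact S ℕ} (hf : f ∈ A.inst)
    (hfG : f ∉ G) {i i' : Fin (S.arity f.rel)} (hi : f.args i ∉ Set.range A.point)
    (h : Relation.ReflTransGen (Link G (Set.range A.point)) (f.args i) (f.args i')) : i = i' := by
  by_contra hne
  obtain ⟨m, x, hx0, hxm, hstep, hinj, hshort⟩ := exists_chain_without_shortcut h
  have hxD : ∀ j ≤ m, x j ∉ Set.range A.point := by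
    rintro (_ | j) hj
    · rwa [hx0]
    · exact (hstep j (by omega)).2.1
  have hsucc : ∀ j : Fin (m + 1), (j : ℕ) < m → ((j + 1 : Fin (m + 1)) : ℕ) = j + 1 :=
    fun j hj => Fin.val_add_one_of_lt (by rw [Fin.lt_def]; simpa using hj)
  -- The chain is closed into a cycle by `f`, used from position `i'` back to `i` at the last index,
  -- where `j + 1` wraps to `0`. For `m = 0` the cycle is `f` alone with a repeated element.
  have key : ∀ j : Fin (m + 1), ∃ g ∈ A.inst, ∃ s t, s ≠ t ∧ g.args s = x j ∧
      g.args t = x ((j + 1 : Fin (m + 1)) : ℕ) ∧ ((j : ℕ) < m → g ∈ G) ∧ ((j : ℕ) = m → g = f) := by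
    intro j
    rcases Nat.lt_succ_iff_lt_or_eq.1 j.2 with hj | hj
    · obtain ⟨-, -, g, hg, ⟨s, hs⟩, t, ht⟩ := hstep j hj
      refine ⟨g, hG hg, s, t, ?_, hs, by rw [hsucc j hj, ht], fun _ => hg, fun h => by omega⟩
      rintro rfl
      have := hinj j hj.le (j + 1) hj (hs.symm.trans ht)
      omega
    · refine ⟨f, hf, i', i, Ne.symm hne, by rw [hj, hxm], ?_, fun h => by omega, fun _ => rfl⟩
      obtain rfl : j = Fin.last m := Fin.ext hj
      rw [Fin.last_add_one, Fin.val_zero, hx0]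
  choose fact hmem src tgt hst hsrc htgt hfG' hff using key
  have hle : ∀ j : Fin (m + 1), (j : ℕ) ≤ m := fun j => Nat.lt_succ_iff.1 j.2
  -- A fact of `G` used twice would give a shortcut from `x j` to `x (l + 1)`; the closing fact `f`
  -- is not in `G`.
  have hlt : ∀ j l : Fin (m + 1), (j : ℕ) < l → fact j ≠ fact l := by
    intro j l hjl heq
    have hjm : (j : ℕ) < m := hjl.trans_le (hle l)
    rcases (hle l).lt_or_eq with hl | hl
    · have hlink : Link G (Set.range A.point) (x j) (x (l + 1)) := by
        refine ⟨hxD _ (hle j), hxD _ hl, fact l, hfG' l hl, ?_, tgt l, by rw [htgt, hsucc l hl]⟩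
        rw [← heq]
        exact ⟨_, hsrc j⟩
      have := hshort j (hle j) (l + 1) hl hlink
      omega
    · exact hfG (hff l hl ▸ heq ▸ hfG' j hjm)
  obtain ⟨j, a, hja⟩ := hA
    { n := m
      elt := fun j => x j
      fact := fact
      fact_mem := hmem
      elt_injective := fun j l h => Fin.ext (hinj j (hle j) l (hle l) h)
      fact_injective := fun j l h => by
        by_contra hjl
        rcases lt_or_gt_of_ne hjl with h' | h'
        · exact hlt j l h' h
        · exact hlt l j h' h.symm
      src := src
      tgt := tgt
      src_ne_tgt := hst
      args_src := hsrc
      args_tgt := htgt }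
  exact hxD j (hle j) ⟨a, hja.symm⟩

/-! ### Quotients that preserve non-answers -/

/-- The facts of `G` hold in `I` under an assignment that maps `hd` to `a` and `y` to `x`. -/
def HoldsAt {S : Schema} {k : ℕ} {V : Type} (G : Instance S ℕ) (hd : Fin k → ℕ) (I : Instance S V)
    (a : Fin k → V) (y : ℕ) (x : V) : Prop :=
  ∃ u : ℕ → V, (∀ f ∈ G, f.map u ∈ I) ∧ (∀ i, u (hd i) = a i) ∧ u y = x

section Lift

variable {S : Schema} {k : ℕ} {V T : Type} {c : CQ S k} {I : Instance S V} {a : Fin k → V}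
  {τ : V → T} {v : ℕ → T}

theorem exists_fact_of_map_mem_image {f : Fact S ℕ} (h : f.map v ∈ Fact.map τ '' I) :
    ∃ t : Fin (S.arity f.rel) → V, (⟨f.rel, t⟩ : Fact S V) ∈ I ∧ ∀ i, τ (t i) = v (f.args i) := by
  obtain ⟨R, s⟩ := f
  obtain ⟨⟨R', t⟩, hg, h⟩ := h
  simp only [Fact.map, Fact.mk.injEq] at h
  obtain ⟨rfl, h⟩ := h
  exact ⟨t, hg, fun i => congrFun (eq_of_heq h) i⟩

/-- A step of the lifting of an assignment along `τ`. -/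
theorem holdsAt_of_forall_diff (hc : c.canonicalInstance.CAcyclic)
    {G : Instance S ℕ} (hG : G ⊆ {f | f ∈ c.body}) {f : Fact S ℕ} (hf : f ∈ G)
    {t : Fin (S.arity f.rel) → V} (ht : (⟨f.rel, t⟩ : Fact S V) ∈ I)
    (htD : ∀ i j, f.args i = c.head j → t i = a j)
    (H : ∀ i, f.args i ∉ Set.range c.head → HoldsAt (G \ {f}) c.head I a (f.args i) (t i))
    {y : ℕ} {x : V} (hy : y ∉ Set.range c.head) (H0 : HoldsAt (G \ {f}) c.head I a y x)
    (hyG : (∃ i, f.args i = y) ∨ y ∉ adom G) :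
    ∃ x', HoldsAt G c.head I a y x' ∧ ((∃ i, f.args i = y ∧ x' = t i) ∨ x' = x) := by
  classical
  set D := Set.range c.head
  let R := Relation.ReflTransGen (Link (G \ {f}) D)
  obtain ⟨u₀, hu₀, hd₀, hy₀⟩ := H0
  have : Nonempty V := ⟨x⟩
  choose! w hw hwd hwt using H
  -- Glued assignment: `w i` on the component of `f.args i` in `G \ {f}`, and `u₀` off these
  -- components. c-acyclicity makes them disjoint, so the choice is immaterial (`hR`).
  let u : ℕ → V := fun z =>
    if h : ∃ i, f.args i ∉ D ∧ R (f.args i) z then w h.choose z else u₀ z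
  have hR : ∀ {i z}, f.args i ∉ D → R (f.args i) z → u z = w i z := by
    intro i z hi hz
    have h : ∃ i, f.args i ∉ D ∧ R (f.args i) z := ⟨i, hi, hz⟩
    have hsymm : Std.Symm (Link (G \ {f}) D) := ⟨fun _ _ => Link.symm⟩
    have : h.choose = i := hc.eq_of_linked (G := G \ {f}) (Set.sdiff_subset.trans hG) (hG hf)
      (fun h => h.2 rfl) h.choose_spec.1 (h.choose_spec.2.trans (Std.Symm.symm _ _ hz))
    simp only [u, dif_pos h, this]
  have hR' : ∀ {z}, (¬ ∃ i, f.args i ∉ D ∧ R (f.args i) z) → u z = u₀ z := fun h => dif_neg h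
  have hud : ∀ i, u (c.head i) = a i := by
    intro i
    by_cases h : ∃ j, f.args j ∉ D ∧ R (f.args j) (c.head i)
    · obtain ⟨j, hj, hjR⟩ := h
      rw [hR hj hjR, hwd j hj]
    · rw [hR' h, hd₀]
  have huf : ∀ i, u (f.args i) = t i := by
    intro i
    by_cases hi : f.args i ∈ D
    · obtain ⟨j, hj⟩ := hi
      rw [← hj, hud, htD i j hj.symm]
    · rw [hR hi .refl, hwt i hi]
  have huG : ∀ g ∈ G, g.map u ∈ I := by
    intro g hg
    by_cases hgf : g = f
    · subst hgf
      have : g.map u = ⟨g.rel, t⟩ := by simp only [Fact.map, huf]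
      rwa [this]
    · have hg' : g ∈ G \ {f} := ⟨hg, hgf⟩
      -- All non-distinguished elements of `g` lie in the same component or all outside, and the
      -- glued assignments agree on `D`.
      by_cases h : ∃ j i, g.args j ∉ D ∧ f.args i ∉ D ∧ R (f.args i) (g.args j)
      · obtain ⟨j, i, hj, hi, hij⟩ := h
        have : g.map u = g.map (w i) := Fact.map_congr fun l => by
          by_cases hl : g.args l ∈ D
          · obtain ⟨b, hb⟩ := hl
            rw [← hb, hud, hwd i hi]
          · exact hR hi (hij.tail ⟨hj, hl, g, hg', ⟨j, rfl⟩, l, rfl⟩)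
        rw [this]
        exact hw i hi g hg'
      · have : g.map u = g.map u₀ := Fact.map_congr fun l => by
          by_cases hl : g.args l ∈ D
          · obtain ⟨b, hb⟩ := hl
            rw [← hb, hud, hd₀]
          · exact hR' fun ⟨i, hi, hil⟩ => h ⟨l, i, hl, hi, hil⟩
        rw [this]
        exact hu₀ g hg'
  refine ⟨u y, ⟨u, huG, hud, rfl⟩, ?_⟩
  rcases hyG with ⟨i, rfl⟩ | hyG
  · exact .inl ⟨i, rfl, huf i⟩
  · refine .inr ?_
    rw [hR', hy₀]
    rintro ⟨i, hi, hiy⟩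
    rcases Relation.ReflTransGen.cases_tail hiy with h | ⟨z, -, -, -, g, hg, -, hj⟩
    · exact hyG ⟨f, hf, i, h.symm⟩
    · exact hyG ⟨g, hg.1, hj⟩

/-- Suppose that `τ` separates the distinguished elements from all others, and that elements with
the same value under `τ` satisfy the same rooted subqueries of `c`. Then answers to the c-acyclic
query `c` on the image under `τ` lift. -/
theorem CQ.mem_answers_of_quotient (hc : c.canonicalInstance.CAcyclic) [Nonempty V]
    (hτa : ∀ i x, τ x = τ (a i) → x = a i)
    (hτ : ∀ G : Instance S ℕ, G ⊆ {f | f ∈ c.body} → ∀ y ∈ adom {f | f ∈ c.body}, ∀ x x',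
      τ x = τ x' → HoldsAt G c.head I a y x → HoldsAt G c.head I a y x')
    (h : τ ∘ a ∈ c.answers (Fact.map τ '' I)) : a ∈ c.answers I := by
  classical
  obtain ⟨v, hv, hva⟩ := h
  -- Induction on the number of conjuncts, with the value `x` of a root `y` prescribed in the class
  -- `v y`; a root outside `c` is unconstrained.
  have main : ∀ (n : ℕ) (G : Instance S ℕ), G.ncard = n → G ⊆ {f | f ∈ c.body} →
      ∀ y ∉ Set.range c.head, ∀ x, (y ∈ adom {f | f ∈ c.body} → τ x = v y) →
        HoldsAt G c.head I a y x := by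
    intro n
    induction n using Nat.strong_induction_on with
    | _ n ih =>
    intro G hn hG y hy x hx
    have hGfin : G.Finite := c.body.finite_toSet.subset hG
    have step : ∀ f ∈ G, (∃ i, f.args i = y) ∨ y ∉ adom G → HoldsAt G c.head I a y x := by
      intro f hf hfy
      have ihf := ih _ (hn ▸ Set.ncard_sdiff_singleton_lt_of_mem hf hGfin) (G \ {f}) rfl
        (Set.sdiff_subset.trans hG)
      obtain ⟨t, ht, htv⟩ := exists_fact_of_map_mem_image (hv f (hG hf))
      obtain ⟨x', hx', ⟨i, rfl, rfl⟩ | rfl⟩ := holdsAt_of_forall_diff hc hG hf ht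
        (fun i j hij => hτa j _ (by rw [htv, hij]; exact hva j))
        (fun i hi => ihf _ hi _ fun _ => htv i) hy (ihf y hy x hx) hfy
      · have hm : f.args i ∈ adom {f | f ∈ c.body} := ⟨f, hG hf, i, rfl⟩
        -- The lifted fact may give the root a value other than `x`, but in the same class, hence
        -- satisfying the same rooted subqueries.
        exact hτ G hG _ hm _ _ (by rw [htv, hx hm]) hx'
      · exact hx'
    by_cases hyG : y ∈ adom G
    · obtain ⟨f, hf, hi⟩ := hyG
      exact step f hf (.inl hi)
    · rcases G.eq_empty_or_nonempty with rfl | ⟨f, hf⟩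
      -- Without conjuncts only the head values matter; they are consistent, since equal answer
      -- variables force equal values of `τ ∘ a`, and `τ` separates distinguished elements.
      · refine ⟨fun z => if h : ∃ i, c.head i = z then a h.choose else x, fun f hf => hf.elim,
          fun i => ?_, dif_neg hy⟩
        have h : ∃ j, c.head j = c.head i := ⟨i, rfl⟩
        refine (dif_pos h).trans (hτa _ _ ?_)
        have h1 := hva h.choose
        rw [h.choose_spec, hva i] at h1
        exact h1.symm
      · exact step f hf (.inr hyG)
  -- A fresh variable serves as a dummy root.
  obtain ⟨y, hy⟩ := ((Set.finite_range c.head).union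
    (adom_finite (I := {f | f ∈ c.body}) c.body.finite_toSet)).exists_notMem
  obtain ⟨u, hu, hua, -⟩ := main _ _ rfl le_rfl y (fun h => hy (.inl h))
    (Classical.arbitrary V) fun h => absurd (.inr h) hy
  exact ⟨u, hu, hua⟩

end Lift

/-- Instances without the answer `a` have images of bounded size without the answer. -/
theorem UCQ.CAcyclic.exists_bounded_quotient {S : Schema} {k : ℕ} {q : UCQ S k} (hq : q.CAcyclic) :
    ∃ n : ℕ, ∀ (I : Instance S ℕ) (a : Fin k → ℕ), a ∉ q.answers I →
      ∃ τ : ℕ → ℕ, (∀ x, τ x < n) ∧ τ ∘ a ∉ q.answers (Fact.map τ '' I) := by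
  let N : Set (CQ S k × Instance S ℕ × ℕ) := {p | p.1 ∈ q.disjuncts ∧
    p.2.1 ⊆ {f | f ∈ p.1.body} ∧ p.2.2 ∈ adom {f | f ∈ p.1.body}}
  have hN : N.Finite := by
    have : N ⊆ ⋃ c ∈ {c | c ∈ q.disjuncts}, ({c} : Set (CQ S k)) ×ˢ
        (𝒫 {f | f ∈ c.body}) ×ˢ adom {f | f ∈ c.body} := by
      rintro ⟨c, G, y⟩ ⟨h1, h2, h3⟩
      exact Set.mem_biUnion (x := c) h1 ⟨rfl, h2, h3⟩
    refine (q.disjuncts.finite_toSet.biUnion fun c _ => ?_).subset this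
    exact (Set.finite_singleton c).prod (c.body.finite_toSet.finite_subsets.prod
      (adom_finite c.body.finite_toSet))
  have := hN.to_subtype
  -- The bound is the number of conceivable classes, which depends on neither `I` nor `a`.
  obtain ⟨n, ⟨φ⟩⟩ := Finite.exists_equiv_fin (Set (Fin k) × Set N)
  refine ⟨n, fun I a ha => ?_⟩
  let ρ : ℕ → Set (Fin k) × Set N := fun x =>
    ({i | a i = x}, {p | HoldsAt p.1.2.1 p.1.1.head I a p.1.2.2 x})
  have hρ : ∀ {x x'}, (φ (ρ x) : ℕ) = φ (ρ x') → ρ x = ρ x' := fun h => φ.injective (Fin.ext h)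
  refine ⟨fun x => φ (ρ x), fun x => (φ (ρ x)).2, fun ⟨c, hc, h⟩ => ha ⟨c, hc, ?_⟩⟩
  refine CQ.mem_answers_of_quotient (hq c hc) (fun i x hx => ?_)
    (fun G hG y hy x x' hx hGx => ?_) h
  · have h1 : i ∈ (ρ x).1 := by
      rw [hρ hx]
      exact rfl
    exact h1.symm
  · have h1 : (⟨(c, G, y), hc, hG, hy⟩ : N) ∈ (ρ x).2 := hGx
    rw [hρ hx] at h1
    exact h1

/-! ### Examples -/

theorem UCQ.map_mem_answers {S : Schema} {k : ℕ} {V W : Type} (q : UCQ S k) {I : Instance S V}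
    {J : Instance S W} {g : V → W} (hg : IsHom g I J) {t : Fin k → V} (ht : t ∈ q.answers I) :
    g ∘ t ∈ q.answers J := by
  obtain ⟨c, hc, v, hv, hvt⟩ := ht
  exact ⟨c, hc, g ∘ v, fun a ha => hg _ (hv a ha), fun i => congrArg g (hvt i)⟩

theorem UCQ.mem_adom_of_mem_answers {S : Schema} {k : ℕ} {V : Type} {q : UCQ S k}
    {I : Instance S V} {t : Fin k → V} (ht : t ∈ q.answers I) (i : Fin k) : t i ∈ adom I := by
  obtain ⟨c, hc, v, hv, hvt⟩ := ht
  obtain ⟨a, ha, j, hj⟩ := c.safe i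
  exact ⟨_, hv a ha, j, (congrArg v hj).trans (hvt i)⟩

theorem finite_pointedInstances {S : Schema} {k : ℕ} {Z : Set (Instance S ℕ × (Fin k → ℕ))}
    (hZ : Z.Finite) : {A : PointedInstance S k | (A.inst, A.point) ∈ Z}.Finite := by
  refine hZ.preimage (f := fun A : PointedInstance S k => (A.inst, A.point))
    (Function.Injective.injOn ?_)
  rintro ⟨I, _, a, _⟩ ⟨J, _, b, _⟩ h
  obtain ⟨rfl, rfl⟩ := Prod.mk.inj h
  rfl

/-- A finite instance has a finite universal model; the homomorphisms from its input copy to an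
instance of a generalized right-adjoint give homomorphisms from this model. -/
theorem exists_finite_universal_model {S : Schema} {Γ : Set (TGD S)} (hfin : Γ.Finite)
    (hwa : (tgdProgram Γ).WeaklyAcyclic) {Ω : Instance S ℕ → Set (Instance S ℕ × (ℕ →. ℕ))}
    (hΩ : (tgdProgram Γ).IsGeneralizedRightAdjoint Ω) {J : Instance S ℕ} (hJ : J.Finite) :
    ∃ (M : Instance S ℕ) (e : ℕ → ℕ), M.Finite ∧ Models M Γ ∧ IsHom e J M ∧
      (∀ (N : Instance S ℕ) (h : ℕ → ℕ), Models N Γ → IsHom h J N →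
        ∃ g : ℕ → ℕ, IsHom g M N ∧ ∀ a ∈ adom J, g (e a) = h a) ∧
      ∀ (B : Instance S ℕ) (ι : ℕ →. ℕ), B.Finite → (J, ι) ∈ Ω B →
        ∃ g : ℕ → ℕ, IsHom g M B ∧ ∀ a ∈ adom J, g (e a) ∈ ι a := by
  have : Nonempty (ChaseTerm S ℕ) := ⟨.base 0⟩
  obtain ⟨M, φ, ψ, hM, hMΓ, hφ, hψ, hψφ⟩ :=
    exists_nat_copy (chase_finite hfin hwa hJ) (models_chase Γ J)
  have hbase : ∀ a ∈ adom J, ChaseTerm.base a ∈ adom (chase Γ J) := fun a ha =>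
    (isHom_chase Γ J).mem_adom ha
  refine ⟨M, φ ∘ .base, hM, hMΓ, fun f hf => hφ _ (isHom_chase Γ J f hf), ?_, ?_⟩
  · intro N h hN hh
    obtain ⟨g, hg, hgh⟩ := exists_hom_of_chase hN hh
    exact ⟨g ∘ ψ, fun f hf => hg _ (hψ f hf), fun a ha => by
      simp only [Function.comp, hψφ _ (hbase a ha), hgh]⟩
  · intro B ι hB hι
    let e : ℕ ↪ ChaseTerm S ℕ := ⟨.base, fun _ _ h => ChaseTerm.base.inj h⟩
    have hu : (tgdProgram Γ).IsUniversalSolution J e (solutionOf J e (chase Γ J)) :=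
      isUniversalSolution_solutionOf (models_chase Γ J) (isHom_chase Γ J) fun X _ N h hN hh =>
        let ⟨g, hg, hgh⟩ := exists_hom_of_chase hN hh
        ⟨g, hg, fun a _ => hgh a⟩
    -- The identity of `J` transposes to a homomorphism from the chase, as `P(J)`, to `B`.
    obtain ⟨g, hg, hc⟩ := ((hΩ B hB).2.2 ℕ _ J e _ hu).2 _ hι id fun f hf => hf
    refine ⟨g ∘ ψ, fun f hf => hg _ (hψ f hf), fun a ha => ?_⟩
    simp only [Function.comp, hψφ _ (hbase a ha)]
    exact hc a ha (hbase a ha)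

end TGDChar

/-! ### The characterizing collection -/

open TGDChar in
theorem mainTheorem11 (S : TGDChar.Schema) (Γ : Set (TGDChar.TGD S)) (hfin : Γ.Finite)
    (hwa : (TGDChar.tgdProgram Γ).WeaklyAcyclic)
    (hadj : (TGDChar.tgdProgram Γ).HasGeneralizedRightAdjoint)
    (k : ℕ) (q : TGDChar.UCQ S k) (hq : q.CAcyclic) :
    ∃ E : TGDChar.LabeledExamples S k, E.Satisfy Γ ∧ E.UniquelyCharacterizes Γ q := by
  obtain ⟨Ω, hΩ⟩ := hadj
  obtain ⟨n, hn⟩ := hq.exists_bounded_quotient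
  have hmodel := fun (J : Instance S ℕ) (hJ : J.Finite) =>
    exists_finite_universal_model hfin hwa hΩ hJ
  choose! M e hM hMΓ he huniv hι using hmodel
  have hfacts : {f : Fact S ℕ | ∀ i, f.args i ∈ Set.Iio n}.Finite :=
    finite_facts_of_values (Set.finite_Iio n)
  let 𝓑 : Set (Instance S ℕ) := 𝒫 {f | ∀ i, f.args i ∈ Set.Iio n}
  have h𝓑 : ∀ B ∈ 𝓑, B.Finite := fun B hB => hfacts.subset hB
  let Zp : Set (Instance S ℕ × (Fin k → ℕ)) := ⋃ c ∈ {c | c ∈ q.disjuncts},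
    {(M {f | f ∈ c.body}, e {f | f ∈ c.body} ∘ c.head)}
  -- All lifts `b'` along `ι` of non-answers `b` on the bounded instances.
  let Zn : Set (Instance S ℕ × (Fin k → ℕ)) := ⋃ B ∈ 𝓑, ⋃ p ∈ Ω B,
    (fun b' => (M p.1, e p.1 ∘ b')) '' {b' | (∀ i, b' i ∈ adom p.1) ∧
      ∃ b, b ∉ q.answers B ∧ ∀ i, b i ∈ p.2 (b' i)}
  have hZp : Zp.Finite := q.disjuncts.finite_toSet.biUnion fun c _ => Set.finite_singleton _
  have hZn : Zn.Finite := by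
    refine hfacts.finite_subsets.biUnion fun B hB => (hΩ B (h𝓑 B hB)).1.biUnion fun p hp => ?_
    have hp' := ((hΩ B (h𝓑 B hB)).2.1 p hp).1
    exact ((Set.Finite.pi' fun _ => adom_finite hp').subset fun b' hb' => hb'.1).image _
  have hbody : ∀ c : CQ S k, ({f | f ∈ c.body} : Instance S ℕ).Finite := fun c =>
    c.body.finite_toSet
  refine ⟨⟨_, _, finite_pointedInstances hZp, finite_pointedInstances hZn⟩, ⟨?_, ?_⟩,
    ⟨?_, ?_⟩, ?_⟩
  · intro A hA
    obtain ⟨c, hc, hA⟩ := Set.mem_iUnion₂.1 hA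
    rw [(Prod.mk.inj hA).1]
    exact hMΓ _ (hbody c)
  · intro A hA
    obtain ⟨B, hB, hA⟩ := Set.mem_iUnion₂.1 hA
    obtain ⟨p, hp, b', hb', hA⟩ := Set.mem_iUnion₂.1 hA
    rw [← (Prod.mk.inj hA).1]
    exact hMΓ _ ((hΩ B (h𝓑 B hB)).2.1 p hp).1
  · intro A hA
    obtain ⟨c, hc, hA⟩ := Set.mem_iUnion₂.1 hA
    rw [(Prod.mk.inj hA).1, (Prod.mk.inj hA).2]
    exact ⟨c, hc, _, he _ (hbody c), fun _ => rfl⟩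
  · intro A hA
    obtain ⟨B, hB, hA⟩ := Set.mem_iUnion₂.1 hA
    obtain ⟨⟨J, ι⟩, hp, b', ⟨hb', b, hb, hbι⟩, hA⟩ := Set.mem_iUnion₂.1 hA
    rw [← (Prod.mk.inj hA).1, ← (Prod.mk.inj hA).2]
    intro hans
    obtain ⟨g, hg, hgι⟩ := hι J ((hΩ B (h𝓑 B hB)).2.1 _ hp).1 B ι (h𝓑 B hB) hp
    refine hb ?_
    -- `ι` is single-valued, so the transpose must send the distinguished tuple to `b`.
    have : b = g ∘ e J ∘ b' := funext fun i => Part.mem_unique (hbι i) (hgι _ (hb' i))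
    rw [this]
    exact q.map_mem_answers hg hans
  · rintro q' ⟨hpos, hneg⟩ I hI hIΓ
    ext t
    constructor
    · rintro ⟨c, hc, v, hv, hvt⟩
      obtain ⟨g, hg, hge⟩ := huniv _ (hbody c) I v hIΓ hv
      have hmem : ∀ i, c.head i ∈ adom {f | f ∈ c.body} := c.safe
      have := q'.map_mem_answers hg (hpos
        ⟨_, hM _ (hbody c), e {f | f ∈ c.body} ∘ c.head, fun i =>
          (he _ (hbody c)).mem_adom (hmem i)⟩ (Set.mem_biUnion (x := c) hc rfl))
      convert this using 1
      exact funext fun i => ((hge _ (hmem i)).trans (hvt i)).symm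
    · intro ht
      by_contra htq
      obtain ⟨τ, hτ, hτq⟩ := hn I t htq
      have hB : Fact.map τ '' I ∈ 𝓑 := by
        rintro _ ⟨f, -, rfl⟩ i
        exact hτ _
      -- As `I ⊨ Γ`, the output reduct here is `I` itself, so `τ` can be transposed.
      have hu : (tgdProgram Γ).IsUniversalSolution I (.refl ℕ) (solutionOf I id I) :=
        isUniversalSolution_solutionOf hIΓ (fun f hf => hf) fun X _ N h _ hh =>
          ⟨h, hh, fun _ _ => rfl⟩
      obtain ⟨p, hp, h', hh', hcomm⟩ := ((hΩ _ (h𝓑 _ hB)).2.2 ℕ ℕ I _ _ hu).1 τ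
        fun f hf => ⟨f, hf, rfl⟩
      have hp' := ((hΩ _ (h𝓑 _ hB)).2.1 p hp).1
      have htI := UCQ.mem_adom_of_mem_answers ht
      refine hneg ⟨M p.1, hM _ hp', e p.1 ∘ h' ∘ t, fun i =>
        (he _ hp').mem_adom (hh'.mem_adom (htI i))⟩ ?_
        (q'.map_mem_answers (he _ hp') (q'.map_mem_answers hh' ht))
      exact Set.mem_biUnion hB (Set.mem_biUnion hp ⟨_, ⟨fun i => hh'.mem_adom (htI i), _, hτq,
        fun i => hcomm _ (htI i) (htI i)⟩, rfl⟩)
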